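/- Theorem 1.2. A partition $\lambda=(\lambda_1\ge\lambda_2\ge\dots\ge\lambda_\ell)$ is a finite (possibly empty) weakly decreasing sequence of positive integers, its parts, and its size is $\sum_i\lambda_i$. It is a $t$-core if none of the hook lengths of the boxes of its Young diagram is a multiple of $t$, and a $(t_1,t_2)$-core if it is both a $t_1$-core and a $t_2$-core. Write $\lfloor x\rfloor$ and $\{x\}=x-\lfloor x\rfloor$ for the integer part and the fractional part of $x$. Let $t\ge 2$ and $m\ge 2$ be integers. Put $$\alpha_{m,t}(x)=\frac{mt+t+x}{2(m+2)},$$ $$F(x)=-\frac{m^2+2m}{2}\,x^2+\frac{m^2t+mt+3m}{2}\,x-mt,\qquad G(x)=-\frac{m^2+2m}{2}\,x^2+\frac{m^2t+mt-m}{2}\,x.$$ For a rational number $a$, let $[a]=\lfloor a\rfloor$ if $\{a\}\le 1/2$ and $[a]=\lfloor a\rfloor+1$ if $\{a\}>1/2$. (1) If $t$ is odd and $t>m+1$, or $t$ is even and $t>2m+3$, then the largest size of a $(t,mt-1)$-core partition with distinct parts is $$\max\bigl(F([\alpha_{m,t}(3)]),\ G([\alpha_{m,t}(-1)])\bigr).$$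 (2) If $t$ is odd and $t\le m+1$, or $t$ is even and $t\le 2m+3$, then the largest size of a $(t,mt-1)$-core partition with distinct parts is $$\max\bigl(F([\alpha_{m,t}(3)]),\ G(\lfloor (t-1)/2\rfloor)\bigr).$$ (3) The number of $(t,mt-1)$-core partitions with distinct parts that have the largest size is at most $2$. -/

import Mathlib

/-! Partitions are represented by their Young diagrams (`YoungDiagram.equivListRowLens` is the
bijection with weakly decreasing lists of positive integers). The size is `YoungDiagram.card`. -/

namespace CorePartition

/-- Hook length of the cell `(i, j)` of `μ`: the number of cells strictly to its right in row `i`,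
plus the number of cells strictly below it in column `j`, plus one for the cell itself.
(Used only at cells of `μ`, where no subtraction truncates.) -/
def hookLength (μ : YoungDiagram) (i j : ℕ) : ℕ :=
  (μ.rowLen i - (j + 1)) + (μ.colLen j - (i + 1)) + 1

/-- `μ` is a `t`-core: no hook length of `μ` is a multiple of `t`. -/
def IsCore (t : ℕ) (μ : YoungDiagram) : Prop :=
  ∀ i j : ℕ, (i, j) ∈ μ → ¬ t ∣ hookLength μ i j

/-- The parts (the row lengths) of `μ` are pairwise distinct. -/
def HasDistinctParts (μ : YoungDiagram) : Prop :=
  μ.rowLens.Nodup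

/-- The set of `(a, b)`-core partitions with distinct parts. -/
def distinctCores (a b : ℕ) : Set YoungDiagram :=
  {μ | IsCore a μ ∧ IsCore b μ ∧ HasDistinctParts μ}

/-- `α_{m,t}(x) = (mt + t + x) / (2(m + 2))`. -/
def alpha (m t : ℕ) (x : ℤ) : ℚ :=
  ((m : ℚ) * t + t + x) / (2 * ((m : ℚ) + 2))

/-- The quadratic `F`. -/
def F (m t : ℕ) (x : ℚ) : ℚ :=
  -x ^ 2 * (((m : ℚ) ^ 2 + 2 * m) / 2) + x * (((m : ℚ) ^ 2 * t + m * t + 3 * m) / 2) - m * t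

/-- The quadratic `G`. -/
def G (m t : ℕ) (x : ℚ) : ℚ :=
  -x ^ 2 * (((m : ℚ) ^ 2 + 2 * m) / 2) + x * (((m : ℚ) ^ 2 * t + m * t - m) / 2)

/-- The nearest integer, with ties rounded down: `⌊a⌋` if the fractional part of `a` is at most
`1/2`, and `⌊a⌋ + 1` otherwise. -/
def nearest (a : ℚ) : ℤ :=
  if Int.fract a ≤ 1 / 2 then ⌊a⌋ else ⌊a⌋ + 1

end CorePartition

namespace CorePartition

open Finset

/-! Encode a partition by the set of its first-column hook lengths. It is a `t`-core when this set
is closed under subtracting `t`, and has distinct parts when the set contains no two consecutive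
integers (`isCore_iff`, `hasDistinctParts_iff`). On an abacus with `t` runners the beads are then
flush, adjacent runners are never both occupied, runner `0` is empty, and the `mt - 1` condition
only caps the runners, at `m` beads or `m - 1` for the last (`exists_admissible`,
`Admissible.exists_distinctCore`).

Twice the size is a strictly convex quadratic in each bead count, so at a maximum every runner is
empty or full (`Admissible.exists_update`). There remains a set of `r` runners, no two adjacent. For
fixed `r` the size grows with the sum of their labels, so the best choice is every other runner
downwards from `t - 2` or from `t - 1`, which gives `G` or `F` at `r`
(`SparseBelow.weight_fill_le`). Both are concave with vertices `alpha m t (-1)` and `alpha m t 3`;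
the nearest integer to the vertex is optimal unless it leaves the range of `r`, which can happen
only for `G`.

For the count, `G - F = m (t - 2r)` at `r`, so `F` can be optimal only at `r = t / 2`. `G` has at
most two maximizers, and if it has two then `F` stays below them (`eq_add_one_of_twiceG_eq`). -/

/-! ### Beta sets: hook lengths, cores and distinct parts -/

/-- The `k`-th first-column hook length of `μ`. -/
def beta (μ : YoungDiagram) (k : ℕ) : ℕ :=
  μ.rowLen k + (μ.colLen 0 - 1 - k)

/-- The set of first-column hook lengths of `μ`. -/
def betaSet (μ : YoungDiagram) : Finset ℕ :=
  (range (μ.colLen 0)).image (beta μ)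

theorem mem_betaSet {μ : YoungDiagram} {x : ℕ} :
    x ∈ betaSet μ ↔ ∃ k < μ.colLen 0, beta μ k = x := by
  simp [betaSet]

theorem lt_colLen_iff_lt_rowLen {μ : YoungDiagram} {i j : ℕ} :
    i < μ.colLen j ↔ j < μ.rowLen i := by
  rw [← YoungDiagram.mem_iff_lt_colLen, YoungDiagram.mem_iff_lt_rowLen]

theorem beta_strictAnti {μ : YoungDiagram} {k l : ℕ} (hkl : k < l) (hl : l < μ.colLen 0) :
    beta μ l < beta μ k := by
  have := μ.rowLen_anti k l hkl.le
  unfold beta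
  omega

theorem beta_lt_iff {μ : YoungDiagram} {k l : ℕ} (hk : k < μ.colLen 0) (hl : l < μ.colLen 0) :
    beta μ l < beta μ k ↔ k < l := by
  refine ⟨fun h => ?_, fun h => beta_strictAnti h hl⟩
  by_contra! hle
  rcases hle.lt_or_eq with h' | rfl
  · exact absurd (beta_strictAnti h' hk) (by omega)
  · omega

theorem beta_injOn (μ : YoungDiagram) : Set.InjOn (beta μ) (range (μ.colLen 0)) := by
  intro k hk l hl h
  simp only [coe_range, Set.mem_Iio] at hk hl
  rcases lt_trichotomy k l with h' | h' | h'
  · exact absurd (beta_strictAnti h' hl) (by omega)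
  · exact h'
  · exact absurd (beta_strictAnti h' hk) (by omega)

theorem card_betaSet (μ : YoungDiagram) : (betaSet μ).card = μ.colLen 0 := by
  rw [betaSet, card_image_of_injOn (beta_injOn μ), card_range]

theorem beta_pos {μ : YoungDiagram} {k : ℕ} (hk : k < μ.colLen 0) : 0 < beta μ k := by
  have := lt_colLen_iff_lt_rowLen.1 hk
  unfold beta
  omega

theorem zero_notMem_betaSet (μ : YoungDiagram) : 0 ∉ betaSet μ := by
  rw [mem_betaSet]
  rintro ⟨k, hk, h⟩
  exact (beta_pos hk).ne' h

/-- A hook length in row `i` is never a difference `beta μ i - beta μ k`. -/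
theorem hookLength_add_beta_ne {μ : YoungDiagram} {i j k : ℕ} (hij : (i, j) ∈ μ)
    (hk : k < μ.colLen 0) : hookLength μ i j + beta μ k ≠ beta μ i := by
  have h1 := YoungDiagram.mem_iff_lt_rowLen.1 hij
  have h2 := YoungDiagram.mem_iff_lt_colLen.1 hij
  have h3 : μ.colLen j ≤ μ.colLen 0 := μ.colLen_anti 0 j (Nat.zero_le _)
  unfold hookLength beta
  -- The hook length minus `beta μ i - beta μ k` is `(rowLen k - j) + (colLen j - k) - 1` over the
  -- integers. The two brackets are both positive or both nonpositive, so this is never zero.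
  rcases lt_or_ge k (μ.colLen j) with h | h
  · have := lt_colLen_iff_lt_rowLen.1 h
    omega
  · have : μ.rowLen k ≤ j := by
      by_contra! h'
      exact absurd (lt_colLen_iff_lt_rowLen.2 h') (by omega)
    omega

theorem hookLength_le_beta {μ : YoungDiagram} {i j : ℕ} (hij : (i, j) ∈ μ) :
    hookLength μ i j ≤ beta μ i := by
  have h1 := YoungDiagram.mem_iff_lt_rowLen.1 hij
  have h2 := YoungDiagram.mem_iff_lt_colLen.1 hij
  have h3 : μ.colLen j ≤ μ.colLen 0 := μ.colLen_anti 0 j (Nat.zero_le _)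
  unfold hookLength beta
  omega

/-- Every `d ≤ beta μ i` such that `beta μ i - d` is not in the beta set is a hook length
in row `i`. -/
theorem exists_hookLength_eq {μ : YoungDiagram} {i y : ℕ} (hi : i < μ.colLen 0)
    (hy : y < beta μ i) (hmem : y ∉ betaSet μ) :
    ∃ j, (i, j) ∈ μ ∧ hookLength μ i j + y = beta μ i := by
  -- `c` counts the beta values above `y`. Hence `y + c - μ.colLen 0` non-members lie below `y`, and
  -- this number is the column sought.
  have hex : ∃ c, c = μ.colLen 0 ∨ beta μ c < y := ⟨_, Or.inl rfl⟩
  obtain ⟨c, hc, hmin⟩ : ∃ c, (c = μ.colLen 0 ∨ beta μ c < y) ∧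
      ∀ k < c, ¬ (k = μ.colLen 0 ∨ beta μ k < y) :=
    ⟨Nat.find hex, Nat.find_spec hex, fun k hk => Nat.find_min hex hk⟩
  have hcl : c ≤ μ.colLen 0 := by
    by_contra! h
    exact hmin _ h (Or.inl rfl)
  have hgt : ∀ k < c, y < beta μ k := by
    intro k hk
    have h1 := hmin k hk
    push Not at h1
    refine lt_of_le_of_ne h1.2 fun h => hmem ?_
    exact mem_betaSet.2 ⟨k, by omega, h.symm⟩
  have hic : i < c := by
    by_contra! h
    rcases hc with h' | h'
    · omega
    · rcases h.lt_or_eq with h2 | rfl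
      · have := beta_strictAnti h2 hi
        omega
      · omega
  have hyc : μ.colLen 0 ≤ y + c := by
    rcases hc with h' | h'
    · omega
    · unfold beta at h'
      omega
  have hlast : y + c - μ.colLen 0 < μ.rowLen (c - 1) := by
    have := hgt (c - 1) (by omega)
    unfold beta at this
    omega
  have hnext : μ.rowLen c ≤ y + c - μ.colLen 0 := by
    rcases hcl.lt_or_eq with h | h
    · rcases hc with h' | h'
      · omega
      · unfold beta at h'
        omega
    · have : ¬ 0 < μ.rowLen c := by
        rw [← lt_colLen_iff_lt_rowLen]
        omega
      omega
  have hcol : μ.colLen (y + c - μ.colLen 0) = c := by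
    have h1 := lt_colLen_iff_lt_rowLen.2 hlast
    have h2 : ¬ c < μ.colLen (y + c - μ.colLen 0) := by
      rw [lt_colLen_iff_lt_rowLen]
      omega
    omega
  have hrow : y + c - μ.colLen 0 < μ.rowLen i := lt_colLen_iff_lt_rowLen.1 (by omega)
  refine ⟨y + c - μ.colLen 0, YoungDiagram.mem_iff_lt_rowLen.2 hrow, ?_⟩
  unfold hookLength beta
  rw [hcol]
  omega

theorem isCore_iff {t : ℕ} (ht : 0 < t) {μ : YoungDiagram} :
    IsCore t μ ↔ ∀ x ∈ betaSet μ, t ≤ x → x - t ∈ betaSet μ := by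
  constructor
  · intro h x hx htx
    obtain ⟨i, hi, rfl⟩ := mem_betaSet.1 hx
    by_contra hmem
    obtain ⟨j, hj, he⟩ := exists_hookLength_eq hi (by omega) hmem
    refine h i j hj ?_
    have : hookLength μ i j = t := by omega
    rw [this]
  · rintro h i j hij ⟨q, hq⟩
    have hi : i < μ.colLen 0 := lt_of_lt_of_le (YoungDiagram.mem_iff_lt_colLen.1 hij)
      (μ.colLen_anti 0 j (Nat.zero_le _))
    -- Repeated subtraction of `t` stays in the beta set, so a hook length `t * q` would be a
    -- difference of two beta values.
    have key : ∀ q, t * q ≤ beta μ i → beta μ i - t * q ∈ betaSet μ := by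
      intro q
      induction q with
      | zero => exact fun _ => mem_betaSet.2 ⟨i, hi, by simp⟩
      | succ q ih =>
        intro hle
        rw [Nat.mul_succ] at hle ⊢
        have := h _ (ih (by omega)) (by omega)
        rwa [Nat.sub_sub] at this
    have hle := hookLength_le_beta hij
    rw [hq] at hle
    obtain ⟨k, hk, he⟩ := mem_betaSet.1 (key q hle)
    refine hookLength_add_beta_ne hij hk ?_
    rw [hq, he]
    omega

/-- From one row to the next, `beta` drops by one more than the row length does; a drop of exactly
one is a repeated part. -/
theorem hasDistinctParts_iff {μ : YoungDiagram} :
    HasDistinctParts μ ↔ ∀ x ∈ betaSet μ, x + 1 ∉ betaSet μ := by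
  have hnd : HasDistinctParts μ ↔
      ∀ k < μ.colLen 0, ∀ l < μ.colLen 0, μ.rowLen k = μ.rowLen l → k = l := by
    unfold HasDistinctParts YoungDiagram.rowLens
    rw [List.nodup_map_iff_inj_on List.nodup_range]
    simp
  rw [hnd]
  constructor
  · intro h x hx hx'
    obtain ⟨k, hk, rfl⟩ := mem_betaSet.1 hx
    obtain ⟨l, hl, he⟩ := mem_betaSet.1 hx'
    have hlk : l < k := (beta_lt_iff hl hk).1 (by omega)
    have := μ.rowLen_anti l k hlk.le
    unfold beta at he
    have := h k hk l hl (by omega)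
    omega
  · intro h
    have key : ∀ k l, k < l → l < μ.colLen 0 → μ.rowLen k ≠ μ.rowLen l := by
      intro k l hkl hl he
      have h1 := μ.rowLen_anti k (k + 1) (by omega)
      have h2 := μ.rowLen_anti (k + 1) l (by omega)
      refine h (beta μ (k + 1)) (mem_betaSet.2 ⟨k + 1, by omega, rfl⟩)
        (mem_betaSet.2 ⟨k, by omega, ?_⟩)
      unfold beta
      omega
    intro k hk l hl he
    rcases lt_trichotomy k l with h' | h' | h'
    · exact absurd he (key k l h' hl)
    · exact h'
    · exact absurd he.symm (key l k h' hk)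

/-! ### Size and reconstruction from the beta set -/

theorem card_eq_sum_rowLen (μ : YoungDiagram) :
    μ.card = ∑ k ∈ range (μ.colLen 0), μ.rowLen k := by
  have h : ∀ c ∈ μ.cells, c.1 ∈ range (μ.colLen 0) := by
    rintro ⟨i, j⟩ hc
    rw [mem_range, ← YoungDiagram.mem_iff_lt_colLen]
    exact μ.up_left_mem le_rfl (Nat.zero_le _) ((YoungDiagram.mem_cells _).1 hc)
  rw [YoungDiagram.card, card_eq_sum_card_fiberwise h]
  refine sum_congr rfl fun k _ => ?_
  rw [YoungDiagram.rowLen_eq_card]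
  rfl

theorem two_mul_card (μ : YoungDiagram) :
    2 * (μ.card : ℤ) =
      2 * ∑ x ∈ betaSet μ, (x : ℤ) - (betaSet μ).card * ((betaSet μ).card - 1) := by
  have h1 : ∑ x ∈ betaSet μ, x = ∑ k ∈ range (μ.colLen 0), beta μ k :=
    sum_image (beta_injOn μ)
  have h2 : ∑ k ∈ range (μ.colLen 0), beta μ k
      = μ.card + ∑ k ∈ range (μ.colLen 0), k := by
    rw [card_eq_sum_rowLen, ← sum_range_reflect (fun k => k), ← sum_add_distrib]
    rfl
  have h3 := Finset.sum_range_id_mul_two (μ.colLen 0)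
  rw [card_betaSet, ← Nat.cast_sum, h1, h2]
  rcases Nat.eq_zero_or_pos (μ.colLen 0) with h0 | h0
  · simp [h0]
  · zify [h0] at h3
    push_cast
    linarith

/-- `beta` lists the set in strictly decreasing order, so the set fixes the list, and the list with
its length fixes the rows. -/
theorem betaSet_injective : Function.Injective betaSet := by
  intro μ ν h
  have hl : μ.colLen 0 = ν.colLen 0 := by rw [← card_betaSet, ← card_betaSet, h]
  have key : ∀ k, k < μ.colLen 0 → beta μ k = beta ν k := by
    intro k
    induction k using Nat.strong_induction_on with
    | _ k ih =>
      intro hk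
      have aux : ∀ {ρ σ : YoungDiagram}, betaSet ρ = betaSet σ → ρ.colLen 0 = σ.colLen 0 →
          k < ρ.colLen 0 → (∀ m < k, beta ρ m = beta σ m) → beta ρ k ≤ beta σ k := by
        intro ρ σ hρσ hl hk hlt
        obtain ⟨l, hl', he⟩ := mem_betaSet.1 (hρσ ▸ mem_betaSet.2 ⟨k, hk, rfl⟩)
        rw [← he]
        rcases lt_trichotomy l k with h' | rfl | h'
        · have := hlt l h'
          have := beta_strictAnti h' hk
          omega
        · exact le_rfl
        · exact (beta_strictAnti h' hl').le
      have hlt : ∀ m < k, beta μ m = beta ν m := fun m hm => ih m hm (by omega)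
      exact le_antisymm (aux h hl hk hlt)
        (aux h.symm hl.symm (hl ▸ hk) fun m hm => (hlt m hm).symm)
  ext ⟨i, j⟩
  rw [YoungDiagram.mem_cells, YoungDiagram.mem_cells, YoungDiagram.mem_iff_lt_rowLen,
    YoungDiagram.mem_iff_lt_rowLen]
  rcases lt_or_ge i (μ.colLen 0) with hi | hi
  · have := key i hi
    unfold beta at this
    rw [show μ.rowLen i = ν.rowLen i by omega]
  · have h1 : ¬ 0 < μ.rowLen i := by
      rw [← lt_colLen_iff_lt_rowLen]
      omega
    have h2 : ¬ 0 < ν.rowLen i := by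
      rw [← lt_colLen_iff_lt_rowLen]
      omega
    omega

theorem exists_rowLen_eq {f : ℕ → ℕ} (hf : Antitone f) {l : ℕ} (hl : ∀ k, l ≤ k → f k = 0) :
    ∃ μ : YoungDiagram, ∀ k, μ.rowLen k = f k := by
  have hmem : ∀ c : ℕ × ℕ, c ∈ (range l ×ˢ range (f 0)).filter (fun c => c.2 < f c.1) ↔
      c.2 < f c.1 := by
    intro c
    simp only [mem_filter, mem_product, mem_range, and_iff_right_iff_imp]
    intro h
    refine ⟨?_, lt_of_lt_of_le h (hf (Nat.zero_le _))⟩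
    by_contra! h'
    rw [hl _ h'] at h
    omega
  refine ⟨⟨(range l ×ˢ range (f 0)).filter (fun c => c.2 < f c.1), ?_⟩, fun k => ?_⟩
  · intro a b hab hb
    rw [mem_coe, hmem] at hb ⊢
    exact lt_of_le_of_lt hab.2 (lt_of_lt_of_le hb (hf hab.1))
  · refine eq_of_forall_lt_iff fun j => ?_
    rw [← YoungDiagram.mem_iff_lt_rowLen, ← YoungDiagram.mem_cells]
    exact hmem (k, j)

/-- If `e i` is the `i`-th smallest element, counted from `0`, the rows are the numbers `e i - i`.
Since `0 ∉ X`, they are all positive and no row is lost. -/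
theorem exists_betaSet_eq {X : Finset ℕ} (hX : 0 ∉ X) : ∃ μ, betaSet μ = X := by
  have hfin : {x | x ∈ X}.Finite := X.finite_toSet
  have hcard : hfin.toFinset.card = X.card := by congr 1; ext; simp
  set e : ℕ → ℕ := Nat.nth (· ∈ X) with he
  have hmem : ∀ i < X.card, e i ∈ X := fun i hi =>
    Nat.nth_mem_of_lt_card hfin (by rw [hcard]; exact hi)
  have hmono : ∀ i, i + 1 < X.card → e i < e (i + 1) := fun i hi =>
    Nat.nth_lt_nth' (Nat.lt_succ_self i) fun _ => by rw [hcard]; exact hi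
  have hsurj : ∀ x ∈ X, ∃ i < X.card, e i = x := by
    intro x hx
    obtain ⟨i, hi, h⟩ := Nat.exists_lt_card_finite_nth_eq hfin hx
    exact ⟨i, by rw [← hcard]; exact hi, h⟩
  have hpos : ∀ i, i < X.card → i < e i := by
    intro i
    induction i with
    | zero =>
      intro h
      refine Nat.pos_of_ne_zero fun h0 => hX ?_
      rw [← h0]
      exact hmem 0 h
    | succ i ih =>
      intro h
      have := ih (by omega)
      have := hmono i h
      omega
  obtain ⟨μ, hμ⟩ := exists_rowLen_eq (l := X.card)
    (f := fun k => if k < X.card then e (X.card - 1 - k) - (X.card - 1 - k) else 0)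
    (by
      refine antitone_nat_of_succ_le fun k => ?_
      split_ifs with h1 h2
      · have := hmono (X.card - 1 - (k + 1)) (by omega)
        rw [show X.card - 1 - (k + 1) + 1 = X.card - 1 - k by omega] at this
        omega
      · omega
      · omega
      · omega)
    (fun k hk => if_neg (by omega))
  have hlen : μ.colLen 0 = X.card := by
    refine eq_of_forall_lt_iff fun k => ?_
    rw [lt_colLen_iff_lt_rowLen, hμ]
    split_ifs with h
    · have := hpos (X.card - 1 - k) (by omega)
      simp only [h, iff_true]
      omega
    · simp [h]
  have hbeta : ∀ k < X.card, beta μ k = e (X.card - 1 - k) := by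
    intro k hk
    have := hpos (X.card - 1 - k) (by omega)
    rw [beta, hlen, hμ, if_pos hk]
    omega
  refine ⟨μ, ?_⟩
  ext x
  rw [mem_betaSet, hlen]
  constructor
  · rintro ⟨k, hk, rfl⟩
    rw [hbeta k hk]
    exact hmem _ (by omega)
  · intro hx
    obtain ⟨i, hi, rfl⟩ := hsurj x hx
    refine ⟨X.card - 1 - i, by omega, ?_⟩
    rw [hbeta _ (by omega)]
    congr 1
    omega

/-! ### The abacus and admissible bead counts -/

/-- The abacus with `n i` flush beads on runner `i < t`. -/
def abacus (t : ℕ) (n : ℕ → ℕ) : Finset ℕ :=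
  (range t).biUnion fun i => (range (n i)).image fun k => i + k * t

theorem mem_abacus {t : ℕ} {n : ℕ → ℕ} {x : ℕ} :
    x ∈ abacus t n ↔ ∃ i < t, ∃ k < n i, i + k * t = x := by
  simp [abacus]

theorem add_mul_mem_abacus {t : ℕ} {n : ℕ → ℕ} {i k : ℕ} (hi : i < t) :
    i + k * t ∈ abacus t n ↔ k < n i := by
  rw [mem_abacus]
  refine ⟨?_, fun h => ⟨i, hi, k, h, rfl⟩⟩
  rintro ⟨j, hj, l, hl, h⟩
  have h1 : j = i := by
    have := congrArg (· % t) h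
    simpa [Nat.mod_eq_of_lt hi, Nat.mod_eq_of_lt hj] using this
  subst h1
  have h2 : l = k := Nat.eq_of_mul_eq_mul_right (by omega) (Nat.add_left_cancel h)
  exact h2 ▸ hl

theorem sum_abacus {t : ℕ} {n : ℕ → ℕ} (f : ℕ → ℤ) :
    ∑ x ∈ abacus t n, f x = ∑ i ∈ range t, ∑ k ∈ range (n i), f (i + k * t) := by
  unfold abacus
  rw [sum_biUnion]
  · refine sum_congr rfl fun i hi => sum_image fun k _ l _ h => ?_
    exact Nat.eq_of_mul_eq_mul_right (Nat.pos_of_ne_zero fun h0 => by simp [h0] at hi)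
      (Nat.add_left_cancel h)
  · intro i hi j hj hij
    rw [Function.onFun, disjoint_left]
    intro x hx hx'
    simp only [mem_image, coe_range, Set.mem_Iio] at hx hx' hi hj
    obtain ⟨k, -, rfl⟩ := hx
    obtain ⟨l, -, h⟩ := hx'
    have := congrArg (· % t) h
    simp [Nat.mod_eq_of_lt hi, Nat.mod_eq_of_lt hj] at this
    exact hij this.symm

/-- Twice the size of the partition with first-column hook set `abacus t n`. -/
def weight (t : ℕ) (n : ℕ → ℕ) : ℤ :=
  ∑ i ∈ range t, (n i * (2 * i + t * (n i - 1)) : ℤ) -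
    (∑ i ∈ range t, (n i : ℤ)) * (∑ i ∈ range t, (n i : ℤ) - 1)

theorem two_mul_card_eq_weight {t : ℕ} {n : ℕ → ℕ} {μ : YoungDiagram}
    (h : betaSet μ = abacus t n) : 2 * (μ.card : ℤ) = weight t n := by
  have hc : ((abacus t n).card : ℤ) = ∑ i ∈ range t, (n i : ℤ) := by
    rw [card_eq_sum_ones]
    push_cast
    rw [sum_abacus]
    simp
  rw [two_mul_card, h, sum_abacus, hc, weight, mul_sum]
  congr 1
  refine sum_congr rfl fun i _ => ?_
  have hg : 2 * ∑ k ∈ range (n i), (k : ℤ) = n i * (n i - 1) := by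
    induction n i with
    | zero => simp
    | succ p ih =>
      rw [sum_range_succ, mul_add, ih]
      push_cast
      ring
  push_cast
  rw [sum_add_distrib, ← sum_mul, sum_const, card_range, nsmul_eq_mul]
  linear_combination (t : ℤ) * hg

/-- The largest number of beads on runner `i` of a `(t, mt - 1)`-core with distinct parts. -/
def cap (t m i : ℕ) : ℕ :=
  if i + 1 = t then m - 1 else m

/-- The bead counts of the `(t, mt - 1)`-cores with distinct parts. -/
structure Admissible (t m : ℕ) (n : ℕ → ℕ) : Prop where
  zero : n 0 = 0
  eq_zero_of_le : ∀ i, t ≤ i → n i = 0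
  le_cap : ∀ i, n i ≤ cap t m i
  sparse : ∀ i, n i = 0 ∨ n (i + 1) = 0

theorem exists_admissible {t m : ℕ} (ht : 2 ≤ t) (hm : 2 ≤ m) {μ : YoungDiagram}
    (hμ : μ ∈ distinctCores t (m * t - 1)) :
    ∃ n, Admissible t m n ∧ betaSet μ = abacus t n := by
  have hmt : 4 ≤ m * t := Nat.mul_le_mul hm ht
  obtain ⟨h1, h2, h3⟩ := hμ
  rw [isCore_iff (by omega)] at h1 h2
  rw [hasDistinctParts_iff] at h3
  have h0 := zero_notMem_betaSet μ
  have hn : ∀ i, ∃ a, ∀ k, i + k * t ∈ betaSet μ ↔ k < a := by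
    intro i
    have hex : ∃ a, i + a * t ∉ betaSet μ := by
      by_contra! hall
      have hinj : Function.Injective fun a => i + a * t := fun a b h =>
        Nat.eq_of_mul_eq_mul_right (by omega) (Nat.add_left_cancel h)
      exact Set.infinite_of_injective_forall_mem hinj hall (betaSet μ).finite_toSet
    refine ⟨Nat.find hex, fun k => ⟨fun hk => ?_, fun hk => not_not.1 (Nat.find_min hex hk)⟩⟩
    by_contra! hle
    -- Above a gap a runner has only gaps, since a bead would slide down into it.
    have hdown : ∀ d, i + (Nat.find hex + d) * t ∉ betaSet μ := by
      intro d
      induction d with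
      | zero => exact Nat.find_spec hex
      | succ d ih =>
        intro hmem
        rw [← add_assoc, Nat.succ_mul] at hmem
        refine ih ?_
        have := h1 _ hmem (by omega)
        rwa [← add_assoc, Nat.add_sub_cancel] at this
    refine hdown (k - Nat.find hex) ?_
    rwa [Nat.add_sub_cancel' hle]
  choose a ha using hn
  have ha0 : ∀ i, a i ≠ 0 → i ∈ betaSet μ := fun i hi => by
    simpa using (ha i 0).2 (Nat.pos_of_ne_zero hi)
  refine ⟨fun i => if i < t then a i else 0, ⟨?_, fun i hi => if_neg (by omega), ?_, ?_⟩, ?_⟩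
  · by_contra h
    rw [if_pos (by omega)] at h
    exact h0 (ha0 0 h)
  · intro i
    split_ifs with hi
    · unfold cap
      split_ifs with hit
      · by_contra! h
        have hmem := (ha i (m - 1)).2 h
        -- An `m`-th bead on the last runner would be `mt - 1` itself, which the second core
        -- condition sends to `0`.
        have heq : i + (m - 1) * t = m * t - 1 := by
          rw [Nat.sub_mul]
          have : t ≤ m * t := Nat.le_mul_of_pos_left t (by omega)
          omega
        rw [heq] at hmem
        have := h2 _ hmem le_rfl
        rw [Nat.sub_self] at this
        exact h0 this
      · by_contra! h
        -- A bead at `i + mt` would force `i + 1` into the beta set next to `i`.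
        have := h2 _ ((ha i m).2 h) (by omega)
        rw [show i + m * t - (m * t - 1) = i + 1 by omega] at this
        exact h3 i (ha0 i (by omega)) this
    · exact Nat.zero_le _
  · intro i
    by_contra! h
    obtain ⟨h4, h5⟩ := h
    have hi : i + 1 < t := by
      by_contra h'
      exact h5 (if_neg h')
    rw [if_pos (by omega)] at h4
    rw [if_pos hi] at h5
    exact h3 i (ha0 i h4) (ha0 _ h5)
  · ext x
    have hx : x % t < t := Nat.mod_lt _ (by omega)
    have hdiv : x % t + x / t * t = x := by
      rw [mul_comm]
      exact Nat.mod_add_div x t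
    rw [← hdiv, add_mul_mem_abacus hx, ha, if_pos hx]

theorem Admissible.exists_distinctCore {t m : ℕ} (ht : 2 ≤ t) (hm : 2 ≤ m) {n : ℕ → ℕ}
    (hn : Admissible t m n) : ∃ μ ∈ distinctCores t (m * t - 1), betaSet μ = abacus t n := by
  have hmt : 4 ≤ m * t := Nat.mul_le_mul hm ht
  have h0 : 0 ∉ abacus t n := by
    have := @add_mul_mem_abacus t n 0 0 (by omega)
    rw [hn.zero] at this
    simpa using this
  obtain ⟨μ, hμ⟩ := exists_betaSet_eq h0
  refine ⟨μ, ⟨?_, ?_, ?_⟩, hμ⟩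
  · rw [isCore_iff (by omega), hμ]
    intro x hx htx
    obtain ⟨i, hi, k, hk, rfl⟩ := mem_abacus.1 hx
    rcases k with _ | k
    · omega
    · rw [Nat.succ_mul, ← add_assoc, Nat.add_sub_cancel, add_mul_mem_abacus hi]
      omega
  · rw [isCore_iff (by omega), hμ]
    intro x hx hle
    -- Every bead lies below `mt - 1`, so the second core condition is vacuous.
    exfalso
    obtain ⟨i, hi, k, hk, rfl⟩ := mem_abacus.1 hx
    have hcap := hn.le_cap i
    unfold cap at hcap
    split_ifs at hcap with hit
    · have : (k + 2) * t ≤ m * t := Nat.mul_le_mul_right t (by omega)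
      rw [add_mul] at this
      omega
    · have : (k + 1) * t ≤ m * t := Nat.mul_le_mul_right t (by omega)
      rw [add_mul] at this
      omega
  · rw [hasDistinctParts_iff, hμ]
    intro x hx hx'
    obtain ⟨i, hi, k, hk, rfl⟩ := mem_abacus.1 hx
    rcases Nat.lt_or_ge (i + 1) t with hit | hit
    · rw [show i + k * t + 1 = i + 1 + k * t by ring, add_mul_mem_abacus hit] at hx'
      have := hn.sparse i
      omega
    -- The successor of a bead on the last runner lies on runner `0`, which is empty.
    · rw [show i + k * t + 1 = 0 + (k + 1) * t by rw [add_mul]; omega,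
        add_mul_mem_abacus (by omega), hn.zero] at hx'
      omega

/-! ### Convexity: runners are empty or full -/

theorem weight_update (t : ℕ) (n : ℕ → ℕ) {i : ℕ} (hi : i < t) :
    ∃ A N : ℤ, ∀ v : ℕ, weight t (Function.update n i v) =
      A + v * (2 * i + t * (v - 1)) - (N + v) * (N + v - 1) := by
  have hsum : ∀ (f : ℕ → ℕ → ℤ) (v : ℕ), ∑ j ∈ range t, f j (Function.update n i v j) =
      ∑ j ∈ (range t).erase i, f j (n j) + f i v := by
    intro f v
    rw [← sum_erase_add _ _ (mem_range.2 hi), Function.update_self]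
    congr 1
    refine sum_congr rfl fun j hj => ?_
    rw [Function.update_of_ne (ne_of_mem_erase hj)]
  refine ⟨∑ j ∈ (range t).erase i, (n j * (2 * j + t * (n j - 1)) : ℤ),
    ∑ j ∈ (range t).erase i, (n j : ℤ), fun v => ?_⟩
  unfold weight
  rw [hsum (fun j a => (a * (2 * j + t * (a - 1)) : ℤ)) v, hsum (fun _ a => (a : ℤ)) v]

/-- Strict convexity with leading coefficient `t - 1`: for this quadratic `f`, `(c - v) f(0) + v
f(c) - c f(v) = (t - 1) v c (c - v) > 0`. -/
theorem quadratic_lt_endpoint {t A N b v c : ℤ} (ht : 2 ≤ t) (hv : 0 < v) (hvc : v < c) :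
    (A + v * (b + t * (v - 1)) - (N + v) * (N + v - 1) < A - N * (N - 1)) ∨
    (A + v * (b + t * (v - 1)) - (N + v) * (N + v - 1) <
      A + c * (b + t * (c - 1)) - (N + c) * (N + c - 1)) := by
  by_contra! h
  obtain ⟨h1, h2⟩ := h
  have h3 : 0 < (t - 1) * (v * (c * (c - v))) :=
    mul_pos (by linarith) (mul_pos hv (mul_pos (by linarith) (by linarith)))
  have h4 := mul_le_mul_of_nonneg_left h1 (show 0 ≤ c - v by linarith)
  have h5 := mul_le_mul_of_nonneg_left h2 hv.le
  linarith

theorem Admissible.update {t m : ℕ} {n : ℕ → ℕ} (hn : Admissible t m n) {i v : ℕ}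
    (hi : n i ≠ 0) (hv : v ≤ cap t m i) : Admissible t m (Function.update n i v) := by
  refine ⟨?_, fun j hj => ?_, fun j => ?_, fun j => ?_⟩
  · rw [Function.update_of_ne, hn.zero]
    rintro rfl
    exact hi hn.zero
  · rw [Function.update_of_ne, hn.eq_zero_of_le j hj]
    rintro rfl
    exact hi (hn.eq_zero_of_le _ hj)
  · rcases eq_or_ne j i with rfl | h
    · rwa [Function.update_self]
    · rw [Function.update_of_ne h]
      exact hn.le_cap j
  · rcases eq_or_ne j i with rfl | h
    · right
      rw [Function.update_of_ne (by omega)]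
      exact (hn.sparse j).resolve_left hi
    · rcases eq_or_ne (j + 1) i with rfl | h'
      · left
        rw [Function.update_of_ne h]
        exact (hn.sparse j).resolve_right hi
      · rw [Function.update_of_ne h, Function.update_of_ne h']
        exact hn.sparse j

theorem Admissible.exists_update {t m : ℕ} (ht : 2 ≤ t) {n : ℕ → ℕ} (hn : Admissible t m n)
    {i : ℕ} (h0 : n i ≠ 0) (hc : n i ≠ cap t m i) :
    ∃ v, (v = 0 ∨ v = cap t m i) ∧ Admissible t m (Function.update n i v) ∧
      weight t n < weight t (Function.update n i v) := by
  have hi : i < t := by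
    by_contra! h
    exact h0 (hn.eq_zero_of_le i h)
  obtain ⟨A, N, hw⟩ := weight_update t n hi
  have hself : weight t n = weight t (Function.update n i (n i)) := by
    rw [Function.update_eq_self]
  have hcap := hn.le_cap i
  rcases quadratic_lt_endpoint (t := t) (A := A) (N := N) (b := 2 * i) (v := n i)
    (c := cap t m i) (by exact_mod_cast ht) (by omega) (by omega) with h | h
  · refine ⟨0, Or.inl rfl, hn.update h0 (Nat.zero_le _), ?_⟩
    rw [hself, hw, hw]
    simpa using h
  · refine ⟨_, Or.inr rfl, hn.update h0 le_rfl, ?_⟩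
    rw [hself, hw, hw]
    exact h

/-- The bead counts that fill exactly the runners in `S`. -/
def fill (t m : ℕ) (S : Finset ℕ) (i : ℕ) : ℕ :=
  if i ∈ S then cap t m i else 0

/-- Positive integers below `t`, no two of them consecutive. -/
structure SparseBelow (t : ℕ) (S : Finset ℕ) : Prop where
  pos : ∀ i ∈ S, 0 < i
  lt : ∀ i ∈ S, i < t
  sparse : ∀ i ∈ S, i + 1 ∉ S

theorem SparseBelow.admissible_fill {t : ℕ} (m : ℕ) {S : Finset ℕ} (hS : SparseBelow t S) :
    Admissible t m (fill t m S) := by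
  refine ⟨if_neg fun h => (hS.pos 0 h).ne' rfl,
    fun i hi => if_neg fun h => absurd (hS.lt i h) (by omega), fun i => ?_, fun i => ?_⟩
  · unfold fill
    split_ifs
    · exact le_rfl
    · exact Nat.zero_le _
  · by_cases h : i ∈ S
    · exact Or.inr (if_neg (hS.sparse i h))
    · exact Or.inl (if_neg h)

theorem Admissible.exists_eq_fill {t m : ℕ} {n : ℕ → ℕ} (hn : Admissible t m n)
    (h : ∀ i, n i = 0 ∨ n i = cap t m i) : ∃ S, SparseBelow t S ∧ n = fill t m S := by
  have hlt : ∀ i, n i ≠ 0 → i < t := fun i hi => by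
    by_contra! h'
    exact hi (hn.eq_zero_of_le i h')
  have hmem : ∀ i, i ∈ (range t).filter (fun i => n i ≠ 0) ↔ n i ≠ 0 := by
    intro i
    simp only [mem_filter, mem_range, and_iff_right_iff_imp]
    exact hlt i
  refine ⟨(range t).filter (fun i => n i ≠ 0), ⟨fun i hi => ?_, fun i hi => ?_, fun i hi => ?_⟩, ?_⟩
  · rw [hmem] at hi
    refine Nat.pos_of_ne_zero ?_
    rintro rfl
    exact hi hn.zero
  · rw [hmem] at hi
    exact hlt i hi
  · rw [hmem] at hi ⊢
    exact not_not.2 ((hn.sparse i).resolve_left hi)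
  · funext i
    unfold fill
    split_ifs with hi
    · exact (h i).resolve_left ((hmem i).1 hi)
    · rw [hmem] at hi
      exact not_not.1 hi

theorem Admissible.exists_weight_le_fill {t m : ℕ} (ht : 2 ≤ t) {n : ℕ → ℕ}
    (hn : Admissible t m n) : ∃ S, SparseBelow t S ∧ weight t n ≤ weight t (fill t m S) := by
  -- The induction is on the number of runners that are neither empty nor full; each update removes
  -- one.
  induction hd : ((range t).filter fun i => n i ≠ 0 ∧ n i ≠ cap t m i).card
    using Nat.strong_induction_on generalizing n with
  | _ d ih =>
    by_cases h : ∀ i, n i = 0 ∨ n i = cap t m i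
    · obtain ⟨S, hS, rfl⟩ := hn.exists_eq_fill h
      exact ⟨S, hS, le_rfl⟩
    · push Not at h
      obtain ⟨i, h0, hc⟩ := h
      obtain ⟨v, hv, hadm, hlt⟩ := hn.exists_update ht h0 hc
      have hlt' : ((range t).filter fun j => Function.update n i v j ≠ 0 ∧
          Function.update n i v j ≠ cap t m j).card < d := by
        rw [← hd]
        refine card_lt_card ⟨fun j hj => ?_, fun hsub => ?_⟩
        · simp only [mem_filter, mem_range] at hj ⊢
          rcases eq_or_ne j i with rfl | hji
          · rw [Function.update_self] at hj
            omega
          · rwa [Function.update_of_ne hji] at hj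
        · have hi : i < t := by
            by_contra! h'
            exact h0 (hn.eq_zero_of_le i h')
          have := hsub (mem_filter.2 ⟨mem_range.2 hi, h0, hc⟩)
          rw [mem_filter, Function.update_self] at this
          omega
      obtain ⟨S, hS, hle⟩ := ih _ hlt' hadm rfl
      exact ⟨S, hS, hlt.le.trans hle⟩

theorem Admissible.eq_fill_of_forall_weight_le {t m : ℕ} (ht : 2 ≤ t) {n : ℕ → ℕ}
    (hn : Admissible t m n) (hmax : ∀ n', Admissible t m n' → weight t n' ≤ weight t n) :
    ∃ S, SparseBelow t S ∧ n = fill t m S := by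
  refine hn.exists_eq_fill fun i => ?_
  by_contra! h
  obtain ⟨v, -, hadm, hlt⟩ := hn.exists_update ht h.1 h.2
  exact absurd (hmax _ hadm) (by omega)

/-! ### Sparse sets of largest sum -/

/-- The set `{T, T - 2, …}` with `r` elements. -/
def top (T r : ℕ) : Finset ℕ :=
  (range r).image fun j => T - 2 * j

theorem mem_top {T r x : ℕ} : x ∈ top T r ↔ ∃ j < r, T - 2 * j = x := by
  simp [top]

theorem top_succ (T r : ℕ) : top T (r + 1) = insert T (top (T - 2) r) := by
  ext x
  rw [mem_insert, mem_top, mem_top]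
  constructor
  · rintro ⟨j, hj, rfl⟩
    rcases j with _ | j
    · exact Or.inl rfl
    · exact Or.inr ⟨j, by omega, by omega⟩
  · rintro (rfl | ⟨j, hj, rfl⟩)
    · exact ⟨0, by omega, rfl⟩
    · exact ⟨j + 1, by omega, by omega⟩

theorem top_injOn {T r : ℕ} (h : 2 * r ≤ T + 1) :
    Set.InjOn (fun j => T - 2 * j) (range r) := by
  intro a ha b hb hab
  simp only [coe_range, Set.mem_Iio] at ha hb hab
  omega

theorem card_top {T r : ℕ} (h : 2 * r ≤ T + 1) : (top T r).card = r := by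
  rw [top, card_image_of_injOn (top_injOn h), card_range]

theorem sum_top {T r : ℕ} (h : 2 * r ≤ T + 1) :
    ∑ x ∈ top T r, (x : ℤ) = r * T - r * (r - 1) := by
  rw [top, sum_image (top_injOn h)]
  induction r with
  | zero => simp
  | succ r ih =>
    rw [sum_range_succ, ih (by omega)]
    push_cast [show 2 * r ≤ T by omega]
    ring

theorem sparseBelow_top {t T r : ℕ} (h : 2 * r ≤ T + 1) (hT : T < t) :
    SparseBelow t (top T r) := by
  refine ⟨fun i hi => ?_, fun i hi => ?_, fun i hi hi' => ?_⟩
  · obtain ⟨j, hj, rfl⟩ := mem_top.1 hi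
    omega
  · obtain ⟨j, hj, rfl⟩ := mem_top.1 hi
    omega
  · obtain ⟨j, hj, rfl⟩ := mem_top.1 hi
    obtain ⟨k, hk, h'⟩ := mem_top.1 hi'
    omega

/-- A set of `r` positive integers up to `T`, no two consecutive, has sum at most that of
`{T, T - 2, …}`, with equality for this set only. -/
theorem SparseBelow.sum_le {S : Finset ℕ} : ∀ {T : ℕ}, SparseBelow (T + 1) S →
    2 * S.card ≤ T + 1 ∧ ∑ x ∈ S, (x : ℤ) ≤ S.card * T - S.card * (S.card - 1) ∧
      (∑ x ∈ S, (x : ℤ) = S.card * T - S.card * (S.card - 1) → S = top T S.card) := by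
  induction S using Finset.induction_on_max with
  | empty => simp [top]
  | insert a s hmax ih =>
    intro T hS
    have ha : a ∉ s := fun h => absurd (hmax a h) (by omega)
    have hapos := hS.pos a (mem_insert_self a s)
    have haT := hS.lt a (mem_insert_self a s)
    have hbelow : ∀ x ∈ s, x + 1 < a := by
      intro x hx
      have h1 := hmax x hx
      have h2 : x + 1 ≠ a := by
        rintro rfl
        exact hS.sparse x (mem_insert_of_mem hx) (mem_insert_self _ s)
      omega
    have hs : SparseBelow (a - 2 + 1) s := by
      refine ⟨fun x hx => hS.pos x (mem_insert_of_mem hx), fun x hx => ?_, fun x hx hx' =>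
        hS.sparse x (mem_insert_of_mem hx) (mem_insert_of_mem hx')⟩
      have := hbelow x hx
      omega
    obtain ⟨h1, h2, h3⟩ := ih hs
    -- The subtraction `a - 2` truncates only when `s` is empty, and then its factor is zero.
    have hcast : (s.card : ℤ) * ((a - 2 : ℕ) : ℤ) = s.card * (a - 2) := by
      rcases s.eq_empty_or_nonempty with rfl | ⟨x, hx⟩
      · simp
      · have := hbelow x hx
        push_cast [show 2 ≤ a by omega]
        ring
    have hcard : 2 * s.card + 1 ≤ a := by
      rcases s.eq_empty_or_nonempty with rfl | ⟨x, hx⟩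
      · simp only [card_empty]
        omega
      · have := hbelow x hx
        omega
    rw [card_insert_of_notMem ha, sum_insert ha]
    rw [hcast] at h2 h3
    have haT' : (a : ℤ) ≤ T := by omega
    have hmul : (s.card : ℤ) * a ≤ s.card * T :=
      mul_le_mul_of_nonneg_left haT' (by positivity)
    push_cast
    refine ⟨by omega, by linarith, fun he => ?_⟩
    have hEq : (a : ℤ) = T := by linarith
    have hEq' : a = T := by exact_mod_cast hEq
    subst hEq'
    rw [top_succ, ← h3 (by linarith)]

/-! ### Sizes of filled abaci and the two quadratics -/

/-- Twice the quadratic `F`. -/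
def twiceF (m t r : ℤ) : ℤ :=
  r * (m ^ 2 * t + m * t + 3 * m) - r ^ 2 * (m ^ 2 + 2 * m) - 2 * m * t

/-- Twice the quadratic `G`. -/
def twiceG (m t r : ℤ) : ℤ :=
  r * (m ^ 2 * t + m * t - m) - r ^ 2 * (m ^ 2 + 2 * m)

/-- The last term measures how far the labels fall short of the sum of `t - 2, t - 4, …`. -/
theorem SparseBelow.weight_fill_of_notMem {t m : ℕ} {S : Finset ℕ} (hS : SparseBelow t S)
    (hlast : t - 1 ∉ S) :
    weight t (fill t m S) = twiceG m t S.card +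
      2 * m * (∑ x ∈ S, (x : ℤ) - (S.card * (t - 2) - S.card * (S.card - 1))) := by
  have hcap : ∀ i ∈ S, cap t m i = m := by
    intro i hi
    refine if_neg fun h => hlast ?_
    rwa [← h, Nat.add_sub_cancel]
  have hsum : ∀ f : ℕ → ℕ → ℤ, (∀ i, f i 0 = 0) →
      ∑ i ∈ range t, f i (fill t m S i) = ∑ i ∈ S, f i m := by
    intro f hf
    rw [← sum_subset (fun i hi => mem_range.2 (hS.lt i hi) : S ⊆ range t)]
    · refine sum_congr rfl fun i hi => ?_
      rw [fill, if_pos hi, hcap i hi]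
    · intro i _ hi
      rw [fill, if_neg hi, hf]
  unfold weight twiceG
  rw [hsum (fun i a => (a * (2 * i + t * (a - 1)) : ℤ)) (by simp),
    hsum (fun _ a => (a : ℤ)) (by simp)]
  rw [← mul_sum, sum_add_distrib, ← mul_sum, sum_const, sum_const, nsmul_eq_mul, nsmul_eq_mul]
  ring

theorem SparseBelow.weight_fill_of_mem {t m : ℕ} (hm : 1 ≤ m) {S : Finset ℕ}
    (hS : SparseBelow t S) (hlast : t - 1 ∈ S) :
    weight t (fill t m S) = twiceF m t S.card +
      2 * m * (∑ x ∈ S, (x : ℤ) - (S.card * (t - 1) - S.card * (S.card - 1))) := by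
  have ht : 1 ≤ t := by
    have := hS.lt _ hlast
    omega
  have hcap : ∀ i ∈ S.erase (t - 1), cap t m i = m := by
    intro i hi
    refine if_neg fun h => ne_of_mem_erase hi ?_
    omega
  -- The last runner is counted with `m` beads and then corrected to its cap `m - 1`.
  have hsum : ∀ f : ℕ → ℕ → ℤ, (∀ i, f i 0 = 0) →
      ∑ i ∈ range t, f i (fill t m S i) = ∑ i ∈ S, f i m - f (t - 1) m + f (t - 1) (m - 1) := by
    intro f hf
    rw [← sum_subset (fun i hi => mem_range.2 (hS.lt i hi) : S ⊆ range t),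
      ← sum_erase_add _ _ hlast, ← sum_erase_add S (fun i => f i m) hlast, add_sub_cancel_right]
    · congr 1
      · refine sum_congr rfl fun i hi => ?_
        rw [fill, if_pos (mem_of_mem_erase hi), hcap i hi]
      · rw [fill, if_pos hlast, cap, if_pos (by omega)]
    · intro i _ hi
      rw [fill, if_neg hi, hf]
  unfold weight twiceF
  rw [hsum (fun i a => (a * (2 * i + t * (a - 1)) : ℤ)) (by simp),
    hsum (fun _ a => (a : ℤ)) (by simp)]
  rw [← mul_sum, sum_add_distrib, ← mul_sum, sum_const, sum_const, nsmul_eq_mul, nsmul_eq_mul]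
  push_cast [ht, hm]
  ring

theorem weight_fill_top_G {t m r : ℕ} (h : 2 * r + 1 ≤ t) :
    SparseBelow t (top (t - 2) r) ∧ weight t (fill t m (top (t - 2) r)) = twiceG m t r := by
  -- For `r = 0` the case `t = 1` is allowed, where `t - 2` truncates.
  rcases Nat.eq_zero_or_pos r with rfl | hr
  · simp [top, weight, fill, twiceG]
    exact ⟨by simp, by simp, by simp⟩
  · have hS : SparseBelow t (top (t - 2) r) := sparseBelow_top (by omega) (by omega)
    refine ⟨hS, ?_⟩
    rw [hS.weight_fill_of_notMem, card_top (by omega), sum_top (by omega)]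
    · push_cast [show 2 ≤ t by omega]
      ring
    · intro hmem
      obtain ⟨j, hj, h'⟩ := mem_top.1 hmem
      omega

theorem weight_fill_top_F {t m r : ℕ} (hm : 1 ≤ m) (hr : 1 ≤ r) (h : 2 * r ≤ t) :
    SparseBelow t (top (t - 1) r) ∧ weight t (fill t m (top (t - 1) r)) = twiceF m t r := by
  have hS : SparseBelow t (top (t - 1) r) := sparseBelow_top (by omega) (by omega)
  refine ⟨hS, ?_⟩
  rw [hS.weight_fill_of_mem hm (mem_top.2 ⟨0, hr, rfl⟩), card_top (by omega), sum_top (by omega)]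
  push_cast [show 1 ≤ t by omega]
  ring

theorem SparseBelow.weight_fill_le {t m : ℕ} (ht : 2 ≤ t) (hm : 1 ≤ m) {S : Finset ℕ}
    (hS : SparseBelow t S) :
    (2 * S.card + 1 ≤ t ∧ weight t (fill t m S) ≤ twiceG m t S.card ∧
      (weight t (fill t m S) = twiceG m t S.card → S = top (t - 2) S.card)) ∨
    (1 ≤ S.card ∧ 2 * S.card ≤ t ∧ weight t (fill t m S) ≤ twiceF m t S.card ∧
      (weight t (fill t m S) = twiceF m t S.card → S = top (t - 1) S.card)) := by
  have hm' : (0 : ℤ) < 2 * m := by omega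
  by_cases hlast : t - 1 ∈ S
  · right
    have hS' : SparseBelow (t - 1 + 1) S := by rwa [Nat.sub_add_cancel (by omega)]
    obtain ⟨h1, h2, h3⟩ := hS'.sum_le
    rw [hS.weight_fill_of_mem hm hlast]
    push_cast [show 1 ≤ t by omega] at h2 h3
    refine ⟨card_pos.2 ⟨_, hlast⟩, by omega, ?_, fun he => h3 ?_⟩
    · have := mul_nonneg hm'.le (sub_nonneg.2 h2)
      linarith
    · have : (2 * m : ℤ) * (∑ x ∈ S, (x : ℤ) - (S.card * (t - 1) - S.card * (S.card - 1))) = 0 := by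
        linarith
      have := (mul_eq_zero.1 this).resolve_left hm'.ne'
      linarith
  · left
    have hS' : SparseBelow (t - 2 + 1) S := by
      refine ⟨hS.pos, fun x hx => ?_, hS.sparse⟩
      have h1 := hS.lt x hx
      have h2 : x ≠ t - 1 := by
        rintro rfl
        exact hlast hx
      omega
    obtain ⟨h1, h2, h3⟩ := hS'.sum_le
    rw [hS.weight_fill_of_notMem hlast]
    push_cast [ht] at h2 h3
    refine ⟨by omega, ?_, fun he => h3 ?_⟩
    · have := mul_nonneg hm'.le (sub_nonneg.2 h2)
      linarith
    · have : (2 * m : ℤ) * (∑ x ∈ S, (x : ℤ) - (S.card * (t - 2) - S.card * (S.card - 1))) = 0 := by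
        linarith
      have := (mul_eq_zero.1 this).resolve_left hm'.ne'
      linarith

/-! ### Nearest integers and maxima of the quadratics -/

theorem twiceF_cast (m t : ℕ) (r : ℤ) : (twiceF m t r : ℚ) = 2 * F m t r := by
  unfold twiceF F
  push_cast
  ring

theorem twiceG_cast (m t : ℕ) (r : ℤ) : (twiceG m t r : ℚ) = 2 * G m t r := by
  unfold twiceG G
  push_cast
  ring

/-- The rounding error lies in `(-1/2, 1/2]`, with a strict end because ties round down;
denominators are cleared. -/
theorem nearest_alpha_bounds (m t : ℕ) (x : ℤ) :
    (2 * nearest (alpha m t x) - 1) * (m + 2) < m * t + t + x ∧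
      m * t + t + x ≤ (2 * nearest (alpha m t x) + 1) * (m + 2) := by
  have key : ∀ a : ℚ, (nearest a : ℚ) - 1 / 2 < a ∧ a ≤ nearest a + 1 / 2 := by
    intro a
    have h1 := Int.self_sub_floor a
    have h2 := Int.fract_nonneg a
    have h3 := Int.fract_lt_one a
    unfold nearest
    split_ifs with h
    · constructor <;> linarith
    · push_cast
      constructor <;> linarith
  obtain ⟨h1, h2⟩ := key (alpha m t x)
  have hpos : (0 : ℚ) < 2 * (m + 2) := by positivity
  have ha : alpha m t x * (2 * (m + 2)) = m * t + t + x := by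
    unfold alpha
    field_simp
  have h1' := mul_lt_mul_of_pos_right h1 hpos
  have h2' := mul_le_mul_of_nonneg_right h2 hpos.le
  rw [ha] at h1' h2'
  constructor
  · have : ((2 * nearest (alpha m t x) - 1 : ℤ) * (m + 2) : ℚ) < m * t + t + x := by
      push_cast
      linarith
    exact_mod_cast this
  · have : (m * t + t + x : ℚ) ≤ (2 * nearest (alpha m t x) + 1 : ℤ) * (m + 2) := by
      push_cast
      linarith
    exact_mod_cast this

/-- The product is the difference of `A x - M x ^ 2` at `k` and at `r`. Each bound is needed only on
the side of `k` where `r` lies, so `k` may also be an end of the range. -/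
theorem mul_sub_mul_nonneg {M A k r : ℤ} (hM : 0 < M) (h1 : r < k → (2 * k - 1) * M ≤ A)
    (h2 : k < r → A ≤ (2 * k + 1) * M) : 0 ≤ (k - r) * (A - M * (k + r)) := by
  rcases lt_trichotomy r k with h | rfl | h
  · have := mul_nonneg hM.le (show 0 ≤ k - 1 - r by omega)
    exact mul_nonneg (by omega) (by linarith [h1 h])
  · simp
  · have := mul_nonneg hM.le (show 0 ≤ r - 1 - k by omega)
    exact mul_nonneg_of_nonpos_of_nonpos (by omega) (by linarith [h2 h])

theorem twiceF_le {m t k r : ℤ} (hm : 0 < m)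
    (h1 : r < k → (2 * k - 1) * (m + 2) ≤ m * t + t + 3)
    (h2 : k < r → m * t + t + 3 ≤ (2 * k + 1) * (m + 2)) : twiceF m t r ≤ twiceF m t k := by
  have := mul_nonneg hm.le (mul_sub_mul_nonneg (by omega) h1 h2)
  unfold twiceF
  linarith

theorem twiceG_le {m t k r : ℤ} (hm : 0 < m)
    (h1 : r < k → (2 * k - 1) * (m + 2) ≤ m * t + t - 1)
    (h2 : k < r → m * t + t - 1 ≤ (2 * k + 1) * (m + 2)) : twiceG m t r ≤ twiceG m t k := by
  have := mul_nonneg hm.le (mul_sub_mul_nonneg (by omega) h1 h2)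
  unfold twiceG
  linarith

/-! ### The largest size -/

theorem exists_size_F {t m : ℕ} (ht : 2 ≤ t) (hm : 2 ≤ m)
    {r : ℕ} (hr : 1 ≤ r) (h : 2 * r ≤ t) :
    ∃ μ ∈ distinctCores t (m * t - 1), 2 * (μ.card : ℤ) = twiceF m t r := by
  obtain ⟨hS, hw⟩ := weight_fill_top_F (m := m) (by omega) hr h
  obtain ⟨μ, hμ, hb⟩ := (hS.admissible_fill m).exists_distinctCore ht hm
  exact ⟨μ, hμ, (two_mul_card_eq_weight hb).trans hw⟩

theorem exists_size_G {t m : ℕ} (ht : 2 ≤ t) (hm : 2 ≤ m)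
    {r : ℕ} (h : 2 * r + 1 ≤ t) :
    ∃ μ ∈ distinctCores t (m * t - 1), 2 * (μ.card : ℤ) = twiceG m t r := by
  obtain ⟨hS, hw⟩ := weight_fill_top_G (m := m) h
  obtain ⟨μ, hμ, hb⟩ := (hS.admissible_fill m).exists_distinctCore ht hm
  exact ⟨μ, hμ, (two_mul_card_eq_weight hb).trans hw⟩

theorem size_le {t m : ℕ} (ht : 2 ≤ t) (hm : 2 ≤ m)
    {μ : YoungDiagram} (hμ : μ ∈ distinctCores t (m * t - 1)) :
    (∃ r : ℕ, 2 * r + 1 ≤ t ∧ 2 * (μ.card : ℤ) ≤ twiceG m t r) ∨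
      ∃ r : ℕ, 1 ≤ r ∧ 2 * r ≤ t ∧ 2 * (μ.card : ℤ) ≤ twiceF m t r := by
  obtain ⟨n, hn, hb⟩ := exists_admissible ht hm hμ
  obtain ⟨S, hS, hle⟩ := hn.exists_weight_le_fill ht
  rw [two_mul_card_eq_weight hb]
  rcases hS.weight_fill_le ht (show 1 ≤ m by omega) with ⟨h1, h2, -⟩ | ⟨h1, h2, h3, -⟩
  · exact Or.inl ⟨_, h1, hle.trans h2⟩
  · exact Or.inr ⟨_, h1, h2, hle.trans h3⟩

theorem isGreatest_size {t m : ℕ} (ht : 2 ≤ t) (hm : 2 ≤ m)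
    {p q : ℤ} (hp : 1 ≤ p) (hpt : 2 * p ≤ t) (hq : 0 ≤ q)
    (hqt : 2 * q + 1 ≤ t) (hF : ∀ r : ℕ, 1 ≤ r → 2 * r ≤ t → twiceF m t r ≤ twiceF m t p)
    (hG : ∀ r : ℕ, 2 * r + 1 ≤ t → twiceG m t r ≤ twiceG m t q) :
    IsGreatest ((fun μ : YoungDiagram => (μ.card : ℚ)) '' distinctCores t (m * t - 1))
      (max (F m t p) (G m t q)) := by
  lift p to ℕ using by omega
  lift q to ℕ using hq
  constructor
  · rcases max_choice (F m t (p : ℤ)) (G m t (q : ℤ)) with h | h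
    · obtain ⟨μ, hμ, he⟩ := exists_size_F ht hm (r := p) (by omega) (by omega)
      refine ⟨μ, hμ, ?_⟩
      rw [h]
      have := twiceF_cast m t p
      rw [← he] at this
      push_cast at this ⊢
      linarith
    · obtain ⟨μ, hμ, he⟩ := exists_size_G ht hm (r := q) (by omega)
      refine ⟨μ, hμ, ?_⟩
      rw [h]
      have := twiceG_cast m t q
      rw [← he] at this
      push_cast at this ⊢
      linarith
  · rintro _ ⟨μ, hμ, rfl⟩
    rcases size_le ht hm hμ with ⟨r, h1, h2⟩ | ⟨r, h1, h2, h3⟩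
    · refine le_max_of_le_right ?_
      have h := twiceG_cast m t q
      have h4 : ((2 * μ.card : ℤ) : ℚ) ≤ twiceG m t q := by
        exact_mod_cast h2.trans (hG r h1)
      rw [h] at h4
      push_cast at h4 ⊢
      linarith
    · refine le_max_of_le_left ?_
      have h := twiceF_cast m t p
      have h4 : ((2 * μ.card : ℤ) : ℚ) ≤ twiceF m t p := by
        exact_mod_cast h3.trans (hF r h1 h2)
      rw [h] at h4
      push_cast at h4 ⊢
      linarith

/-- The integer nearest to the vertex of `F` always lies in the range of `r`, so only the choice of
`q` for `G` depends on the case. -/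
theorem isGreatest_size_of_nearest {t m : ℕ} (ht : 2 ≤ t) (hm : 2 ≤ m)
    {q : ℤ} (hq : 0 ≤ q) (hqt : 2 * q + 1 ≤ t)
    (hG : ∀ r : ℕ, 2 * r + 1 ≤ t → twiceG m t r ≤ twiceG m t q) :
    IsGreatest ((fun μ : YoungDiagram => (μ.card : ℚ)) '' distinctCores t (m * t - 1))
      (max (F m t (nearest (alpha m t 3))) (G m t q)) := by
  obtain ⟨h1, h2⟩ := nearest_alpha_bounds m t 3
  have hm' : (2 : ℤ) ≤ m := by exact_mod_cast hm
  have ht' : (2 : ℤ) ≤ t := by exact_mod_cast ht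
  refine isGreatest_size ht hm ?_ ?_ hq hqt
    (fun r _ _ => twiceF_le (by omega) (fun _ => h1.le) fun _ => h2) hG
  · by_contra! h
    nlinarith
  · by_contra! h
    have hM : (0 : ℤ) ≤ m + 2 := by omega
    -- The bound `2p - 1 ≥ t` only yields `t < 3`; for `t = 2` parity improves it to `2p - 1 ≥ 3`.
    rcases ht'.eq_or_lt with h3 | h3
    · have := mul_le_mul_of_nonneg_right
        (show (3 : ℤ) ≤ 2 * nearest (alpha m t 3) - 1 by omega) hM
      rw [← h3] at h1
      linarith
    · have := mul_le_mul_of_nonneg_right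
        (show (t : ℤ) ≤ 2 * nearest (alpha m t 3) - 1 by omega) hM
      linarith

/-! ### Counting the cores of largest size -/

/-- A core of largest size has one of two extremal shapes, the second only for even `t`. -/
theorem eq_of_size_maximal {t m : ℕ} (ht : 2 ≤ t) (hm : 2 ≤ m)
    {μ : YoungDiagram} (hμ : μ ∈ distinctCores t (m * t - 1))
    (hmax : ∀ ν ∈ distinctCores t (m * t - 1), ν.card ≤ μ.card) :
    (∃ r : ℕ, 2 * r + 1 ≤ t ∧ 2 * (μ.card : ℤ) = twiceG m t r ∧
      betaSet μ = abacus t (fill t m (top (t - 2) r))) ∨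
    ∃ r : ℕ, 2 * r = t ∧ 2 * (μ.card : ℤ) = twiceF m t r ∧
      betaSet μ = abacus t (fill t m (top (t - 1) r)) := by
  have hG : ∀ r : ℕ, 2 * r + 1 ≤ t → twiceG m t r ≤ 2 * (μ.card : ℤ) := by
    intro r h
    obtain ⟨ν, hν, he⟩ := exists_size_G ht hm h
    have := hmax ν hν
    omega
  have hF : ∀ r : ℕ, 1 ≤ r → 2 * r ≤ t → twiceF m t r ≤ 2 * (μ.card : ℤ) := by
    intro r hr h
    obtain ⟨ν, hν, he⟩ := exists_size_F ht hm hr h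
    have := hmax ν hν
    omega
  obtain ⟨n, hn, hb⟩ := exists_admissible ht hm hμ
  have hw := two_mul_card_eq_weight hb
  obtain ⟨S, hS, rfl⟩ := hn.eq_fill_of_forall_weight_le ht fun n' hn' => by
    obtain ⟨ν, hν, hb'⟩ := hn'.exists_distinctCore ht hm
    have := hmax ν hν
    have := two_mul_card_eq_weight hb'
    omega
  rcases hS.weight_fill_le ht (show 1 ≤ m by omega) with ⟨h1, h2, h3⟩ | ⟨h1, h2, h3, h4⟩
  · left
    have he := le_antisymm h2 ((hG _ h1).trans hw.le)
    refine ⟨S.card, h1, hw.trans he, ?_⟩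
    rw [← h3 he]
    exact hb
  · right
    have he := le_antisymm h3 ((hF _ h1 h2).trans hw.le)
    refine ⟨S.card, ?_, hw.trans he, ?_⟩
    · by_contra hne
      -- If `2r < t`, then `G` at the same `r` exceeds `F` by `m (t - 2r) > 0`.
      have h5 := hG S.card (by omega)
      rw [hw.trans he] at h5
      have h6 : (0 : ℤ) < m * (t - 2 * S.card) := mul_pos (by omega) (by omega)
      unfold twiceF twiceG at h5
      linarith
    · rw [← h4 he]
      exact hb

/-- Two distinct maximizers of `G` are adjacent, and then `F` stays below the maximum. -/
theorem eq_add_one_of_twiceG_eq {t m : ℕ} (hm : 2 ≤ m) {V : ℤ}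
    (hG : ∀ r : ℕ, 2 * r + 1 ≤ t → twiceG m t r ≤ V)
    {r s : ℕ} (hrs : r < s) (hs : 2 * s + 1 ≤ t) (h1 : twiceG m t r = V)
    (h2 : twiceG m t s = V) :
    s = r + 1 ∧ ∀ p : ℕ, 2 * p = t → twiceF m t p ≠ V := by
  have hm' : (0 : ℤ) < m := by omega
  -- Equal values of a quadratic lie symmetrically about its vertex.
  have hlin : (m : ℤ) * t + t - 1 = (m + 2) * (r + s) := by
    have : ((m : ℤ) * (s - r)) * (m * t + t - 1 - (m + 2) * (r + s)) = 0 := by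
      unfold twiceG at h1 h2
      linear_combination h2 - h1
    have hne : (m : ℤ) * (s - r) ≠ 0 := (mul_pos hm' (by omega)).ne'
    linarith [(mul_eq_zero.1 this).resolve_left hne]
  -- Otherwise `r + 1` lies strictly between them and gives a larger value by concavity.
  have hsr : s = r + 1 := by
    by_contra hne
    have h3 := hG (r + 1) (by omega)
    have h4 : (0 : ℤ) < m * (m + 2) * (s - r - 1) :=
      mul_pos (mul_pos hm' (by omega)) (by omega)
    have h5 : twiceG m t ((r + 1 : ℕ) : ℤ) - twiceG m t r = m * (m + 2) * (s - r - 1) := by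
      unfold twiceG
      push_cast
      linear_combination (m : ℤ) * hlin
    omega
  refine ⟨hsr, fun p hp he => ?_⟩
  subst hsr
  push_cast at hlin h2
  have ht' : (t : ℤ) = 2 * p := by omega
  -- The vertex of `G` is `r + 1/2`, and that of `F` lies `2 / (m + 2) ≤ 1/2` further right, so `F`
  -- does not increase beyond `r + 1`.
  have h6 : twiceF m t p ≤ twiceF m t ((r : ℤ) + 1) :=
    twiceF_le hm' (fun h => by omega) fun _ => by
      have hm2 : (2 : ℤ) ≤ m := by exact_mod_cast hm
      linarith
  have h7 : twiceF m t ((r : ℤ) + 1) = twiceG m t ((r : ℤ) + 1) - 2 * (m * (t - 2 * (r + 1))) := by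
    unfold twiceF twiceG
    ring
  have h8 : (0 : ℤ) < m * (t - 2 * (r + 1)) := mul_pos hm' (by omega)
  omega

theorem encard_size_maximal_le {t m : ℕ} (ht : 2 ≤ t) (hm : 2 ≤ m) :
    Set.encard {μ ∈ distinctCores t (m * t - 1) |
      ∀ ν ∈ distinctCores t (m * t - 1), ν.card ≤ μ.card} ≤ 2 := by
  by_contra! hlt
  obtain ⟨T, hT, hcard⟩ := Set.exists_subset_encard_eq (Order.add_one_le_of_lt hlt)
  obtain ⟨x, y, z, hxy, hxz, hyz, rfl⟩ := Set.encard_eq_three.1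
    (hcard.trans (by norm_num : (2 : ℕ∞) + 1 = 3))
  obtain ⟨hx, hxmax⟩ := hT (show x ∈ ({x, y, z} : Set YoungDiagram) by simp)
  obtain ⟨hy, hymax⟩ := hT (show y ∈ ({x, y, z} : Set YoungDiagram) by simp)
  obtain ⟨hz, hzmax⟩ := hT (show z ∈ ({x, y, z} : Set YoungDiagram) by simp)
  have hyx : y.card = x.card := le_antisymm (hxmax y hy) (hymax x hx)
  have hzx : z.card = x.card := le_antisymm (hxmax z hz) (hzmax x hx)
  have hG : ∀ r : ℕ, 2 * r + 1 ≤ t → twiceG m t r ≤ 2 * (x.card : ℤ) := by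
    intro r h
    obtain ⟨ν, hν, he⟩ := exists_size_G ht hm h
    have := hxmax ν hν
    omega
  have hadj : ∀ {r s : ℕ}, 2 * r + 1 ≤ t → 2 * s + 1 ≤ t → 2 * (x.card : ℤ) = twiceG m t r →
      2 * (x.card : ℤ) = twiceG m t s → r ≠ s →
      (s = r + 1 ∨ r = s + 1) ∧ ∀ p : ℕ, 2 * p = t → 2 * (x.card : ℤ) ≠ twiceF m t p := by
    intro r s hr hs h1 h2 hrs
    rcases hrs.lt_or_gt with h | h
    · obtain ⟨h3, h4⟩ := eq_add_one_of_twiceG_eq hm hG h hs h1.symm h2.symm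
      exact ⟨Or.inl h3, fun p hp he => h4 p hp he.symm⟩
    · obtain ⟨h3, h4⟩ := eq_add_one_of_twiceG_eq hm hG h hr h2.symm h1.symm
      exact ⟨Or.inr h3, fun p hp he => h4 p hp he.symm⟩
  have hne : ∀ {μ ν : YoungDiagram} {f : ℕ → Finset ℕ} {r s : ℕ}, μ ≠ ν → betaSet μ = f r →
      betaSet ν = f s → r ≠ s := by
    rintro μ ν f r s hμν h1 h2 rfl
    exact hμν (betaSet_injective (h1.trans h2.symm))
  have hx' := eq_of_size_maximal ht hm hx hxmax
  have hy' := eq_of_size_maximal ht hm hy hymax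
  have hz' := eq_of_size_maximal ht hm hz hzmax
  rw [hyx] at hy'
  rw [hzx] at hz'
  -- Three integers cannot be pairwise adjacent, two shapes of type `G` exclude type `F`, and type
  -- `F` has the single parameter `t / 2`.
  rcases hx' with ⟨a, ha, hxa, hxb⟩ | ⟨a, ha, hxa, hxb⟩ <;>
  rcases hy' with ⟨b, hb, hya, hyb⟩ | ⟨b, hb, hya, hyb⟩ <;>
  rcases hz' with ⟨c, hc, hza, hzb⟩ | ⟨c, hc, hza, hzb⟩
  · have h1 := hne (f := fun r => abacus t (fill t m (top (t - 2) r))) hxy hxb hyb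
    have h2 := hne (f := fun r => abacus t (fill t m (top (t - 2) r))) hxz hxb hzb
    have h3 := hne (f := fun r => abacus t (fill t m (top (t - 2) r))) hyz hyb hzb
    have h4 := (hadj ha hb hxa hya h1).1
    have h5 := (hadj ha hc hxa hza h2).1
    have h6 := (hadj hb hc hya hza h3).1
    omega
  · have h1 := hne (f := fun r => abacus t (fill t m (top (t - 2) r))) hxy hxb hyb
    exact (hadj ha hb hxa hya h1).2 c hc hza
  · have h1 := hne (f := fun r => abacus t (fill t m (top (t - 2) r))) hxz hxb hzb
    exact (hadj ha hc hxa hza h1).2 b hb hya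
  · exact hne (f := fun r => abacus t (fill t m (top (t - 1) r))) hyz hyb hzb (by omega)
  · have h1 := hne (f := fun r => abacus t (fill t m (top (t - 2) r))) hyz hyb hzb
    exact (hadj hb hc hya hza h1).2 a ha hxa
  · exact hne (f := fun r => abacus t (fill t m (top (t - 1) r))) hxz hxb hzb (by omega)
  · exact hne (f := fun r => abacus t (fill t m (top (t - 1) r))) hxy hxb hyb (by omega)
  · exact hne (f := fun r => abacus t (fill t m (top (t - 1) r))) hxy hxb hyb (by omega)

theorem floor_sub_one_div_two {t : ℕ} (ht : 1 ≤ t) :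
    ⌊((t : ℚ) - 1) / 2⌋ = (((t - 1) / 2 : ℕ) : ℤ) := by
  have h : ((t : ℚ) - 1) / 2 = ((t - 1 : ℕ) : ℚ) / (2 : ℕ) := by
    push_cast [ht]
    rfl
  rw [h, Rat.floor_natCast_div_natCast]
  rfl

end CorePartition

theorem theorem1p2 (t m : ℕ) (ht : 2 ≤ t) (hm : 2 ≤ m) :
    ((Odd t ∧ m + 1 < t ∨ Even t ∧ 2 * m + 3 < t) →
      IsGreatest ((fun μ : YoungDiagram => (μ.card : ℚ)) ''
          CorePartition.distinctCores t (m * t - 1))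
        (max (CorePartition.F m t (CorePartition.nearest (CorePartition.alpha m t 3)))
          (CorePartition.G m t (CorePartition.nearest (CorePartition.alpha m t (-1)))))) ∧
    ((Odd t ∧ t ≤ m + 1 ∨ Even t ∧ t ≤ 2 * m + 3) →
      IsGreatest ((fun μ : YoungDiagram => (μ.card : ℚ)) ''
          CorePartition.distinctCores t (m * t - 1))
        (max (CorePartition.F m t (CorePartition.nearest (CorePartition.alpha m t 3)))
          (CorePartition.G m t (⌊((t : ℚ) - 1) / 2⌋ : ℤ)))) ∧
    Set.encard {μ ∈ CorePartition.distinctCores t (m * t - 1) |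
      ∀ ν ∈ CorePartition.distinctCores t (m * t - 1), ν.card ≤ μ.card} ≤ 2 := by
  have hm' : (2 : ℤ) ≤ m := by exact_mod_cast hm
  have ht' : (2 : ℤ) ≤ t := by exact_mod_cast ht
  refine ⟨fun hcase => ?_, fun hcase => ?_, CorePartition.encard_size_maximal_le ht hm⟩
  · obtain ⟨h1, h2⟩ := CorePartition.nearest_alpha_bounds m t (-1)
    refine CorePartition.isGreatest_size_of_nearest ht hm ?_ ?_
      fun r _ => CorePartition.twiceG_le (by omega) (fun _ => h1.le) fun _ => h2
    · by_contra! h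
      nlinarith
    · by_contra! h
      -- Leaving the range means `2q ≥ t`. For odd `t` this gives `2q - 1 ≥ t`, which is impossible;
      -- for even `t` it would force `t < m + 1`.
      rcases hcase with ⟨⟨k, hk⟩, hlt⟩ | ⟨⟨k, hk⟩, hlt⟩
      · have : (t : ℤ) ≤ 2 * CorePartition.nearest (CorePartition.alpha m t (-1)) - 1 := by omega
        have := mul_le_mul_of_nonneg_right this (show (0 : ℤ) ≤ m + 2 by omega)
        have : (m : ℤ) + 1 < t := by exact_mod_cast hlt
        linarith
      · have : (t : ℤ) - 1 ≤ 2 * CorePartition.nearest (CorePartition.alpha m t (-1)) - 1 := by omega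
        have := mul_le_mul_of_nonneg_right this (show (0 : ℤ) ≤ m + 2 by omega)
        have : 2 * (m : ℤ) + 3 < t := by exact_mod_cast hlt
        nlinarith
  · rw [CorePartition.floor_sub_one_div_two (by omega)]
    -- Here `q` is the largest allowed `r`, so only the bound for smaller `r` has to be checked.
    refine CorePartition.isGreatest_size_of_nearest ht hm (by omega) (by omega)
      fun r hr => CorePartition.twiceG_le (by omega) (fun hrq => ?_) fun _ => by omega
    rcases hcase with ⟨⟨k, hk⟩, hle⟩ | ⟨⟨k, hk⟩, hle⟩
    · have h : 2 * (((t - 1) / 2 : ℕ) : ℤ) - 1 = t - 2 := by omega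
      have : (t : ℤ) ≤ m + 1 := by exact_mod_cast hle
      rw [h]
      linarith
    · have h : 2 * (((t - 1) / 2 : ℕ) : ℤ) - 1 = t - 3 := by omega
      have : (t : ℤ) ≤ 2 * m + 3 := by exact_mod_cast hle
      rw [h]
      linarith
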